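/- Let $p$ be an odd prime and let $\mathcal{N}$ be the Nottingham group over $\mathbb{F}_p$, that is, the group of all ring automorphisms $f$ of the formal power series ring $\mathbb{F}_p[[t]]$ such that $f(t)=t+\sum_{i\ge 2}a_it^i$ for some $a_i\in\mathbb{F}_p$. For elements $x,y$ of a group $G$ put $$\Sigma(x,y)=\bigcup_{g\in G}\left(\langle x\rangle^g\cup\langle y\rangle^g\cup\langle xy\rangle^g\right),$$ and call a finite group $G$ a Beauville group if there are $x_1,y_1,x_2,y_2\in G$ with $\langle x_1,y_1\rangle=\langle x_2,y_2\rangle=G$ and $\Sigma(x_1,y_1)\cap\Sigma(x_2,y_2)=\{1\}$. Let $n_0=2$ if $p>3$ and $n_0=5$ if $p=3$. Then for every integer $n\ge n_0$ there exists a quotient of $\mathcal{N}$ of order $p^n$ which is a Beauville group. In particular, for every $n\ge 5$ the Nottingham group over $\mathbb{F}_3$ has a quotient of order $3^n$ which is a Beauville group, so that these quotients form an infinite family of Beauville $3$-groups. -/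

import Mathlib

/-- The set `Σ(x, y)`: the union over `g ∈ G` of the conjugates `⟨x⟩^g ∪ ⟨y⟩^g ∪ ⟨xy⟩^g`,
where `w^g = g⁻¹ w g`. -/
def beauvilleSigma {G : Type*} [Group G] (x y : G) : Set G :=
  {z | ∃ g w : G, (w ∈ Subgroup.zpowers x ∨ w ∈ Subgroup.zpowers y ∨
    w ∈ Subgroup.zpowers (x * y)) ∧ z = g⁻¹ * w * g}

/-- The generating pairs `{x₁, y₁}` and `{x₂, y₂}` form an (unmixed) Beauville structure for `G`. -/
def IsBeauvilleStructure {G : Type*} [Group G] (x₁ y₁ x₂ y₂ : G) : Prop :=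
  Subgroup.closure {x₁, y₁} = (⊤ : Subgroup G) ∧
  Subgroup.closure {x₂, y₂} = (⊤ : Subgroup G) ∧
  beauvilleSigma x₁ y₁ ∩ beauvilleSigma x₂ y₂ = {1}

/-- A Beauville group: a finite group possessing an (unmixed) Beauville structure. -/
def IsBeauvilleGroup (G : Type*) [Group G] : Prop :=
  Finite G ∧ ∃ x₁ y₁ x₂ y₂ : G, IsBeauvilleStructure x₁ y₁ x₂ y₂

/-- The Nottingham group over `𝔽_p`: the group of normalised automorphisms of the ring
`𝔽_p[[t]]`, that is, of the ring automorphisms `f` with `f(t) = t + ∑_{i ≥ 2} a_i t^i`. -/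
def nottinghamGroup (p : ℕ) [Fact p.Prime] :
    Subgroup (PowerSeries (ZMod p) ≃+* PowerSeries (ZMod p)) where
  carrier := {f | (PowerSeries.X : PowerSeries (ZMod p)) ^ 2 ∣ f PowerSeries.X - PowerSeries.X}
  one_mem' := by simp
  mul_mem' := by
    rintro f g ⟨u, hu⟩ ⟨v, hv⟩
    have hf : f PowerSeries.X = PowerSeries.X * (1 + PowerSeries.X * u) := by
      linear_combination hu
    have hg : f (g PowerSeries.X) - f PowerSeries.X = f PowerSeries.X ^ 2 * f v := by
      rw [← map_sub, hv, map_mul, map_pow]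
    refine ⟨u + (1 + PowerSeries.X * u) ^ 2 * f v, ?_⟩
    rw [RingAut.mul_apply]
    rw [hf] at hg
    linear_combination hg
  inv_mem' := by
    rintro f ⟨u, hu⟩
    have hY : f⁻¹ PowerSeries.X = f.symm PowerSeries.X := rfl
    have h1 : PowerSeries.X - f.symm PowerSeries.X = f.symm PowerSeries.X ^ 2 * f.symm u := by
      have := congrArg f.symm hu
      simpa using this
    have h2 : PowerSeries.X ∣ f.symm (PowerSeries.X : PowerSeries (ZMod p)) := by
      rw [PowerSeries.X_dvd_iff]
      by_contra h
      have h3 : IsUnit (f.symm (PowerSeries.X : PowerSeries (ZMod p))) := by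
        rw [PowerSeries.isUnit_iff_constantCoeff]
        exact isUnit_iff_ne_zero.mpr h
      have h4 : IsUnit (PowerSeries.X : PowerSeries (ZMod p)) := by
        simpa using h3.map f
      exact PowerSeries.X_prime.not_isUnit h4
    obtain ⟨w, hw⟩ := h2
    refine ⟨-(w ^ 2 * f.symm u), ?_⟩
    rw [hY]
    rw [hw] at h1 ⊢
    linear_combination -h1

/-!
Write `N_k` for the group of the `f` in the Nottingham group `N` with `f(t) ≡ t` modulo
`t ^ (k + 1)`, and say that `f` has depth `k` if it lies in `N_k` but not in `N_{k+1}`. The quotient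
`N/N_3` is `𝔽_p²`, with coordinates `lin f = a` and `quad f = b - a²` for `f(t) = t + a t² + b t³ + ⋯`.

The key observation is that, for `p` odd, the elements commuting with an `f` of depth `1` remember
the direction of `f` in `N/N_3`: by the commutator formula (`X_pow_dvd_comm`) their depth `d` is
congruent to `1` modulo `p`, and comparing `f(g(t))` with `g(f(t))` two orders further shows that
for `d ≥ 2` their coefficients `α`, `β` at depths `d` and `d + 1` satisfy `lin f * β = quad f * α`
(`lin_mul_depthCoeff_succ`). Since `N_d / N_{d+2}` is central in `N / N_{d+2}` when `d ≡ 1`, this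
ratio is invariant under conjugation, so powers of elements of different directions cannot be
conjugate as long as both coefficients are visible in the quotient. For `n ≢ 1` modulo `p` this is
always so in `N/N_{n+1}`. For `n ≡ 1` one divides instead by the subgroup `W` of index `p` of `N_n`
on which the coefficients at depths `n` and `n + 1` agree: `W` swallows all the powers lying in `N_n`
of an element of direction `(1, 1)`, so the argument still applies to such an element
(`meetsTrivially_of_quad_eq_lin`).

The first triple consists of `x₁ = t / (1 - t)` and `y₁ = t / (1 - 2 t²) ^ (1/2)`, both of order `p`
and of directions `(1, 0)` and `(0, 1)`, and of their product, of direction `(1, 1)`. Nontrivial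
powers of an element of order `p` keep its direction, so they are never conjugate to powers of
elements of another direction (`meetsTrivially_of_pow_eq_one`). If `p ≥ 5`, there are enough directions
left for a disjoint second triple. If `p = 3`, the second triple has directions `(1, 0)`, `(0, -1)`
and `(1, -1)`, and its first two elements are `x₁` and `y₁⁻¹` multiplied by elements of depths
`5` and `4`; these are depths that no commutator with `x₁`, respectively `y₁⁻¹`, can have, so
that the new elements are not conjugate to the old ones (`meetsTrivially_mul`). This is where
`n ≥ 5` is needed.
-/

namespace Nottingham

open PowerSeries

variable {p : ℕ} [Fact p.Prime]

/-! ### Ring endomorphisms of `𝔽_p[[t]]` -/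

section Endomorphisms

variable {F : Type*} [FunLike F (ZMod p)⟦X⟧ (ZMod p)⟦X⟧]
  [RingHomClass F (ZMod p)⟦X⟧ (ZMod p)⟦X⟧] (f : F)

lemma map_C (a : ZMod p) : f (C a) = C a :=
  congrArg (fun g : ZMod p →+* (ZMod p)⟦X⟧ => g a)
    (Subsingleton.elim (((f : (ZMod p)⟦X⟧ →+* (ZMod p)⟦X⟧)).comp C) C)

lemma X_pow_dvd_map_sub {k : ℕ} (hf : X ^ (k + 1) ∣ f X - X) (w : (ZMod p)⟦X⟧) :
    X ^ (k + 1) ∣ f w - w := by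
  suffices h : ∀ m ≤ k + 1, ∀ w : (ZMod p)⟦X⟧, X ^ m ∣ f w - w from h _ le_rfl w
  intro m
  induction m with
  | zero => simp
  | succ m ih =>
    intro hm w
    obtain ⟨v, hv⟩ : (X : (ZMod p)⟦X⟧) ∣ w - C (constantCoeff w) := by
      rw [X_dvd_iff]; simp
    generalize constantCoeff w = a at hv
    obtain rfl : w = C a + X * v := by linear_combination hv
    have h : f (C a + X * v) - (C a + X * v) = (f X - X) * f v + X * (f v - v) := by
      rw [map_add, map_mul, map_C]; ring
    rw [h, pow_succ']
    refine dvd_add (Dvd.dvd.mul_right (dvd_trans ?_ hf) _)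
      (mul_dvd_mul_left _ (ih (by omega) v))
    rw [← pow_succ']
    exact pow_dvd_pow _ hm

lemma exists_one_add_pow (y : (ZMod p)⟦X⟧) (m : ℕ) :
    ∃ r, (1 + y) ^ m = 1 + (m : (ZMod p)⟦X⟧) * y + y ^ 2 * r := by
  induction m with
  | zero => exact ⟨0, by simp⟩
  | succ m ih =>
    obtain ⟨r, hr⟩ := ih
    refine ⟨m + r * (1 + y), ?_⟩
    rw [pow_succ, hr]
    push_cast
    ring

/-- The first-order effect of `X ↦ X + X ^ (i + 1) u` on `X ^ m e`. -/
lemma X_pow_dvd_map_X_pow_mul_sub {i : ℕ} (hi : 1 ≤ i) {u : (ZMod p)⟦X⟧}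
    (hf : f X = X + X ^ (i + 1) * u) (m : ℕ) (e : (ZMod p)⟦X⟧) :
    X ^ (m + i + 1) ∣ f (X ^ m * e) - X ^ m * e - (m : (ZMod p)⟦X⟧) * X ^ (m + i) * (u * e) := by
  obtain ⟨w, hw⟩ := X_pow_dvd_map_sub f (k := i) ⟨u, by rw [hf]; ring⟩ e
  obtain ⟨r, hr⟩ := exists_one_add_pow (X ^ i * u) m
  obtain ⟨j, rfl⟩ := Nat.exists_eq_add_of_le hi
  have h1 : f X ^ m = X ^ m * (1 + X ^ (1 + j) * u) ^ m := by
    rw [hf, ← mul_pow]; ring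
  have hw' : f e = e + X ^ (1 + j + 1) * w := by linear_combination hw
  refine ⟨X ^ j * u ^ 2 * r * f e + (1 + (m : (ZMod p)⟦X⟧) * X ^ (1 + j) * u) * w, ?_⟩
  rw [map_mul, map_pow, h1, hr, hw']
  ring

lemma X_pow_dvd_map_sub_of_dvd {i : ℕ} (hi : 1 ≤ i) (hf : X ^ (i + 1) ∣ f X - X) {m : ℕ}
    {z : (ZMod p)⟦X⟧} (hz : X ^ m ∣ z) : X ^ (m + i) ∣ f z - z := by
  obtain ⟨u, hu⟩ := hf
  obtain ⟨e, rfl⟩ := hz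
  have h := X_pow_dvd_map_X_pow_mul_sub f hi (u := u) (by linear_combination hu) m e
  have h2 := dvd_add ((pow_dvd_pow _ (Nat.le_succ _)).trans h)
    (Dvd.intro ((m : (ZMod p)⟦X⟧) * (u * e)) rfl : X ^ (m + i) ∣ X ^ (m + i) * _)
  convert h2 using 1
  ring

end Endomorphisms

/-- An `X`-adically contracting self-map of `𝔽_p[[X]]` has a fixed point. -/
lemma exists_fixedPoint (Φ : (ZMod p)⟦X⟧ → (ZMod p)⟦X⟧)
    (h : ∀ m u v, X ^ m ∣ u - v → X ^ (m + 1) ∣ Φ u - Φ v) : ∃ u, Φ u = u := by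
  have step : ∀ n, X ^ n ∣ Φ^[n + 1] 0 - Φ^[n] 0 := by
    intro n
    induction n with
    | zero => simp
    | succ n ih =>
      rw [Function.iterate_succ_apply' Φ (n + 1), Function.iterate_succ_apply' Φ n]
      rw [Function.iterate_succ_apply'] at ih
      exact h _ _ _ ih
  have cauchy : ∀ n k, X ^ n ∣ Φ^[n + k] 0 - Φ^[n] 0 := by
    intro n k
    induction k with
    | zero => simp
    | succ k ih =>
      have := dvd_add ((pow_dvd_pow X (Nat.le_add_right n k)).trans (step (n + k))) ih
      simpa [add_assoc] using this
  let u : (ZMod p)⟦X⟧ := PowerSeries.mk fun n => coeff n (Φ^[n + 1] 0)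
  have hu : ∀ n, X ^ n ∣ u - Φ^[n] 0 := by
    intro n
    rw [X_pow_dvd_iff]
    intro m hm
    obtain ⟨k, rfl⟩ := Nat.exists_eq_add_of_lt hm
    have := (X_pow_dvd_iff.mp (cauchy (m + 1) k)) m (Nat.lt_succ_self m)
    rw [map_sub, sub_eq_zero] at this ⊢
    rw [coeff_mk, ← this]
    congr 2
    ring_nf
  refine ⟨u, ?_⟩
  ext n
  have h1 := h n _ _ (hu n)
  rw [← Function.iterate_succ_apply' Φ] at h1
  have h2 := dvd_sub h1 (hu (n + 1))
  have := X_pow_dvd_iff.mp h2 n (Nat.lt_succ_self n)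
  have e : Φ u - Φ^[n + 1] 0 - (u - Φ^[n + 1] 0) = Φ u - u := by ring
  rwa [e, map_sub, sub_eq_zero] at this

lemma eq_zero_of_forall_X_pow_dvd {z : (ZMod p)⟦X⟧} (h : ∀ m, X ^ m ∣ z) : z = 0 := by
  ext n
  simpa using X_pow_dvd_iff.mp (h (n + 1)) n (Nat.lt_succ_self n)

lemma exists_apply_X (w : (ZMod p)⟦X⟧) :
    ∃ f : nottinghamGroup p, f.1 X = X + X ^ 2 * w := by
  have hs : HasSubst (X + X ^ 2 * w) := HasSubst.of_constantCoeff_zero' (by simp)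
  let φ : (ZMod p)⟦X⟧ →+* (ZMod p)⟦X⟧ := (substAlgHom (R := ZMod p) hs : _ →+* _)
  have hφ : φ X = X + X ^ 2 * w := by
    change substAlgHom (R := ZMod p) hs X = _
    rw [coe_substAlgHom, subst_X hs]
  have hφ1 : X ^ (1 + 1) ∣ φ X - X := ⟨w, by rw [hφ]; ring⟩
  have hb : Function.Bijective φ := by
    constructor
    · rw [injective_iff_map_eq_zero]
      intro z hz
      refine eq_zero_of_forall_X_pow_dvd fun m => ?_
      induction m with
      | zero => simp
      | succ m ih =>
        have := X_pow_dvd_map_sub_of_dvd φ le_rfl hφ1 ih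
        rwa [hz, zero_sub, dvd_neg] at this
    · intro v
      obtain ⟨u, hu⟩ := exists_fixedPoint (fun u => v - (φ u - u)) (by
        intro m a b hab
        have := X_pow_dvd_map_sub_of_dvd φ le_rfl hφ1 hab
        rw [← dvd_neg] at this
        convert this using 1
        rw [map_sub]; ring)
      exact ⟨u, by linear_combination -hu⟩
  refine ⟨⟨RingEquiv.ofBijective φ hb, ?_⟩, ?_⟩
  · change X ^ 2 ∣ φ X - X
    exact hφ1
  · exact hφ

/-! ### The depth filtration and commutators -/

/-- The subgroup `N_k` of the `f` with `f(t) ≡ t` modulo `t ^ (k + 1)`. -/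
def depthSubgroup (p : ℕ) [Fact p.Prime] (k : ℕ) : Subgroup (nottinghamGroup p) where
  carrier := {f | X ^ (k + 1) ∣ f.1 X - X}
  one_mem' := by simp
  mul_mem' := by
    intro f g hf hg
    have h1 := dvd_add (X_pow_dvd_map_sub f.1 hf (g.1 X)) hg
    simpa using h1
  inv_mem' := by
    intro f hf
    have h1 := X_pow_dvd_map_sub f.1 hf ((f⁻¹ : nottinghamGroup p).1 X)
    have h2 : f.1 ((f⁻¹ : nottinghamGroup p).1 X) = X := RingEquiv.apply_symm_apply f.1 X
    rw [h2, ← neg_sub, dvd_neg] at h1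
    exact h1

/-- The coefficient of `t ^ (j + 1)` in `f(t) - t`. -/
noncomputable def depthCoeff (j : ℕ) (f : nottinghamGroup p) : ZMod p := coeff (j + 1) (f.1 X - X)

lemma mem_depthSubgroup {k : ℕ} {f : nottinghamGroup p} :
    f ∈ depthSubgroup p k ↔ X ^ (k + 1) ∣ f.1 X - X := Iff.rfl

lemma mul_apply_X (f g : nottinghamGroup p) : (f * g).1 X = f.1 (g.1 X) := rfl

lemma mem_depthSubgroup_one (f : nottinghamGroup p) : f ∈ depthSubgroup p 1 := f.2

lemma ext_X {f g : nottinghamGroup p} (h : f.1 X = g.1 X) : f = g := by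
  suffices g⁻¹ * f = 1 by rwa [inv_mul_eq_one, eq_comm] at this
  have h1 : (g⁻¹ * f).1 X = X := by
    rw [mul_apply_X, h]
    exact RingEquiv.symm_apply_apply g.1 X
  refine Subtype.ext (RingEquiv.ext fun w => ?_)
  refine sub_eq_zero.mp (eq_zero_of_forall_X_pow_dvd fun m => ?_)
  exact (pow_dvd_pow _ (Nat.le_succ m)).trans
    (X_pow_dvd_map_sub (k := m) (g⁻¹ * f).1 (by rw [h1]; simp) w)

lemma X_pow_dvd_apply (g : nottinghamGroup p) {m : ℕ} {z : (ZMod p)⟦X⟧} (h : X ^ m ∣ z) :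
    X ^ m ∣ g.1 z := by
  have := dvd_add ((pow_dvd_pow X (Nat.le_succ m)).trans
    (X_pow_dvd_map_sub_of_dvd g.1 le_rfl g.2 h)) h
  simpa using this

lemma X_pow_dvd_apply_iff (g : nottinghamGroup p) {m : ℕ} {z : (ZMod p)⟦X⟧} :
    X ^ m ∣ g.1 z ↔ X ^ m ∣ z := by
  refine ⟨fun h => ?_, X_pow_dvd_apply g⟩
  have h1 := X_pow_dvd_apply g⁻¹ h
  rwa [show (g⁻¹).1 (g.1 z) = z from RingEquiv.symm_apply_apply g.1 z] at h1

lemma inv_mul_mem_depthSubgroup {k : ℕ} {f g : nottinghamGroup p} :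
    g⁻¹ * f ∈ depthSubgroup p k ↔ X ^ (k + 1) ∣ f.1 X - g.1 X := by
  rw [mem_depthSubgroup, ← X_pow_dvd_apply_iff g, map_sub, ← mul_apply_X, mul_inv_cancel_left]

lemma depthSubgroup_anti {k l : ℕ} (h : k ≤ l) : depthSubgroup p l ≤ depthSubgroup p k :=
  fun _ hf => (pow_dvd_pow X (Nat.succ_le_succ h)).trans hf

lemma mem_depthSubgroup_iff {k : ℕ} {f : nottinghamGroup p} :
    f ∈ depthSubgroup p k ↔ ∀ j < k, depthCoeff j f = 0 := by
  rw [mem_depthSubgroup, X_pow_dvd_iff]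
  constructor
  · intro h j hj
    exact h (j + 1) (by omega)
  · intro h m hm
    obtain rfl | ⟨j, rfl⟩ : m = 0 ∨ ∃ j, m = j + 1 := by
      cases m with
      | zero => simp
      | succ j => exact Or.inr ⟨j, rfl⟩
    · exact X_pow_dvd_iff.mp f.2 0 (by norm_num)
    · exact h j (by omega)

lemma depthCoeff_eq_zero {k : ℕ} {f : nottinghamGroup p} (hf : f ∈ depthSubgroup p k) {j : ℕ}
    (hj : j < k) : depthCoeff j f = 0 := mem_depthSubgroup_iff.mp hf j hj

lemma mem_depthSubgroup_succ {k : ℕ} {f : nottinghamGroup p} :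
    f ∈ depthSubgroup p (k + 1) ↔ f ∈ depthSubgroup p k ∧ depthCoeff k f = 0 := by
  simp only [mem_depthSubgroup_iff, Nat.lt_succ_iff_lt_or_eq]
  constructor
  · exact fun h => ⟨fun j hj => h j (Or.inl hj), h k (Or.inr rfl)⟩
  · rintro ⟨h1, h2⟩ j (hj | rfl)
    exacts [h1 j hj, h2]

lemma depthCoeff_congr {k : ℕ} {f g : nottinghamGroup p} (h : g⁻¹ * f ∈ depthSubgroup p k)
    {j : ℕ} (hj : j < k) : depthCoeff j f = depthCoeff j g := by
  rw [inv_mul_mem_depthSubgroup, X_pow_dvd_iff] at h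
  have := h (j + 1) (by omega)
  rw [map_sub] at this
  rw [depthCoeff, depthCoeff, map_sub, map_sub]
  linear_combination this

lemma depthCoeff_one (j : ℕ) : depthCoeff j (1 : nottinghamGroup p) = 0 := by
  simp [depthCoeff]

lemma depthCoeff_mul {k j : ℕ} (hk : 1 ≤ k) {f g : nottinghamGroup p}
    (hf : f ∈ depthSubgroup p k) (hg : g ∈ depthSubgroup p k) (hj : j < 2 * k) :
    depthCoeff j (f * g) = depthCoeff j f + depthCoeff j g := by
  have h1 := X_pow_dvd_map_sub_of_dvd f.1 hk hf hg
  have h2 := X_pow_dvd_iff.mp h1 (j + 1) (by omega)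
  have h3 : (f * g).1 X - X = (f.1 X - X) + (g.1 X - X) + (f.1 (g.1 X - X) - (g.1 X - X)) := by
    rw [mul_apply_X, map_sub]; ring
  rw [depthCoeff, h3, map_add, map_add, h2, add_zero]
  rfl

lemma depthCoeff_inv {k j : ℕ} (hk : 1 ≤ k) {f : nottinghamGroup p}
    (hf : f ∈ depthSubgroup p k) (hj : j < 2 * k) :
    depthCoeff j f⁻¹ = - depthCoeff j f := by
  have := depthCoeff_mul hk hf (inv_mem hf) hj
  rw [mul_inv_cancel, depthCoeff_one] at this
  linear_combination -this

lemma X_pow_dvd_of_leading {k : ℕ} {f : nottinghamGroup p} (hf : f ∈ depthSubgroup p k) :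
    ∃ u, f.1 X = X + X ^ (k + 1) * u ∧ constantCoeff u = depthCoeff k f := by
  obtain ⟨u, hu⟩ := hf
  refine ⟨u, by linear_combination hu, ?_⟩
  rw [depthCoeff, hu, mul_comm, coeff_mul_X_pow', if_pos le_rfl]
  simp

/-- The commutator formula: modulo terms of higher depth, `f ∈ N_i` and `g ∈ N_j` commute up to
`(j - i) a b` at depth `i + j`, where `a`, `b` are the leading coefficients. -/
lemma X_pow_dvd_comm {i j : ℕ} (hi : 1 ≤ i) (hj : 1 ≤ j) {f g : nottinghamGroup p}
    (hf : f ∈ depthSubgroup p i) (hg : g ∈ depthSubgroup p j) :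
    X ^ (i + j + 2) ∣ f.1 (g.1 X) - g.1 (f.1 X) -
      C (((j : ZMod p) - i) * depthCoeff i f * depthCoeff j g) * X ^ (i + j + 1) := by
  obtain ⟨u, hu, hu0⟩ := X_pow_dvd_of_leading hf
  obtain ⟨e, he, he0⟩ := X_pow_dvd_of_leading hg
  rw [← hu0, ← he0]
  have h1 := X_pow_dvd_map_X_pow_mul_sub f.1 hi hu (j + 1) e
  have h2 := X_pow_dvd_map_X_pow_mul_sub g.1 hj he (i + 1) u
  obtain ⟨v, hv⟩ : (X : (ZMod p)⟦X⟧) ∣ u * e - C (constantCoeff u * constantCoeff e) := by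
    rw [X_dvd_iff]; simp
  obtain ⟨r, hr⟩ := h1
  obtain ⟨s, hs⟩ := h2
  refine ⟨r - s + ((j : (ZMod p)⟦X⟧) - i) * v, ?_⟩
  have h3 : f.1 (g.1 X) = X + X ^ (i + 1) * u + f.1 (X ^ (j + 1) * e) := by
    rw [he, map_add, hu]
  have h4 : g.1 (f.1 X) = X + X ^ (j + 1) * e + g.1 (X ^ (i + 1) * u) := by
    rw [hu, map_add, he]
  rw [h3, h4]
  simp only [map_mul, map_sub, map_natCast, Nat.cast_add, Nat.cast_one] at hv hr hs ⊢
  linear_combination hr - hs + ((j : (ZMod p)⟦X⟧) - i) * X ^ (i + j + 1) * hv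

/-- `N_d` is normal, and its elements are central modulo `N_{d+1}`; they are even central
modulo `N_{d+2}` when `d ≡ 1` modulo `p`. -/
lemma conj_inv_mul_mem {d : ℕ} (hd : 1 ≤ d) {r : nottinghamGroup p} (hr : r ∈ depthSubgroup p d)
    (g : nottinghamGroup p) : r⁻¹ * (g⁻¹ * r * g) ∈ depthSubgroup p (d + 1) ∧
      ((d : ZMod p) = 1 → r⁻¹ * (g⁻¹ * r * g) ∈ depthSubgroup p (d + 2)) := by
  have h := X_pow_dvd_comm hd le_rfl hr (mem_depthSubgroup_one g)
  have key : r.1 (g.1 X) - g.1 (r.1 X) = g.1 ((g⁻¹ * r * g).1 X - r.1 X) := by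
    rw [map_sub, ← mul_apply_X, ← mul_apply_X g, ← mul_apply_X g]
    congr 3
    group
  rw [key] at h
  rw [inv_mul_mem_depthSubgroup, inv_mul_mem_depthSubgroup, ← X_pow_dvd_apply_iff g]
  constructor
  · have h2 := dvd_add ((pow_dvd_pow X (Nat.le_succ _)).trans h)
      (Dvd.intro_left (C ((((1 : ℕ) : ZMod p) - d) * depthCoeff d r * depthCoeff 1 g)) rfl)
    simpa only [sub_add_cancel] using h2
  · intro h1
    rw [← X_pow_dvd_apply_iff g]
    simpa [h1] using h

instance depthSubgroup_normal (k : ℕ) : (depthSubgroup p k).Normal := by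
  constructor
  intro r hr g
  obtain rfl | hk := Nat.eq_zero_or_pos k
  · exact depthSubgroup_anti (Nat.zero_le 1) (mem_depthSubgroup_one _)
  have h := depthSubgroup_anti (Nat.le_succ k) (conj_inv_mul_mem hk hr g⁻¹).1
  simpa using mul_mem hr h

lemma depthCoeff_conj {d : ℕ} (hd : 1 ≤ d) {r : nottinghamGroup p} (hr : r ∈ depthSubgroup p d)
    (g : nottinghamGroup p) : depthCoeff d (g⁻¹ * r * g) = depthCoeff d r ∧
      ((d : ZMod p) = 1 → depthCoeff (d + 1) (g⁻¹ * r * g) = depthCoeff (d + 1) r) :=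
  ⟨depthCoeff_congr (conj_inv_mul_mem hd hr g).1 (Nat.lt_succ_self d),
    fun h => depthCoeff_congr ((conj_inv_mul_mem hd hr g).2 h) (Nat.lt_succ_self (d + 1))⟩

/-- Nontrivial elements commuting with an element of depth exactly `i` have depth `≡ i`. -/
lemma natCast_eq_of_commute {i d : ℕ} (hi : 1 ≤ i) (hd : 1 ≤ d) {f g : nottinghamGroup p}
    (hf : f ∈ depthSubgroup p i) (hf0 : depthCoeff i f ≠ 0) (hg : g ∈ depthSubgroup p d)
    (hg0 : depthCoeff d g ≠ 0) (h : f * g = g * f) : (d : ZMod p) = i := by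
  have h1 := X_pow_dvd_comm hi hd hf hg
  rw [← mul_apply_X, ← mul_apply_X, h, sub_self, zero_sub, dvd_neg] at h1
  have h2 := X_pow_dvd_iff.mp h1 (i + d + 1) (Nat.lt_succ_self _)
  rw [coeff_C_mul, coeff_X_pow_self, mul_one, mul_assoc] at h2
  exact sub_eq_zero.mp ((mul_eq_zero.mp h2).resolve_right (mul_ne_zero hf0 hg0))

lemma depthCoeff_two_mul (f g : nottinghamGroup p) : depthCoeff 2 (f * g) =
    depthCoeff 2 f + depthCoeff 2 g + 2 * depthCoeff 1 f * depthCoeff 1 g := by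
  obtain ⟨u, hu, hu0⟩ := X_pow_dvd_of_leading (mem_depthSubgroup_one f)
  obtain ⟨e, he, he0⟩ := X_pow_dvd_of_leading (mem_depthSubgroup_one g)
  have h1 := X_pow_dvd_map_X_pow_mul_sub f.1 le_rfl hu 2 e
  have h2 := X_pow_dvd_iff.mp h1 3 (by norm_num)
  have h3 : (f * g).1 X - X = (f.1 X - X) + (g.1 X - X) +
      (f.1 (X ^ 2 * e) - X ^ 2 * e - ((2 : ℕ) : (ZMod p)⟦X⟧) * X ^ (2 + 1) * (u * e)) +
      C 2 * (X ^ 3 * (u * e)) := by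
    have hC : C (2 : ZMod p) = 2 := map_ofNat C 2
    rw [mul_apply_X, he, map_add, hC]; push_cast; ring
  rw [depthCoeff, h3, map_add, map_add, map_add, h2, add_zero, coeff_C_mul, mul_comm (X ^ 3),
    coeff_mul_X_pow', if_pos le_rfl, Nat.sub_self, coeff_zero_eq_constantCoeff_apply, map_mul,
    hu0, he0, ← mul_assoc]
  rfl

/-- The homomorphism `f ↦ a`, where `f(t) = t + a t² + ⋯`. -/
noncomputable def linHom (p : ℕ) [Fact p.Prime] : nottinghamGroup p →* Multiplicative (ZMod p) where
  toFun f := Multiplicative.ofAdd (depthCoeff 1 f)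
  map_one' := by rw [depthCoeff_one]; rfl
  map_mul' f g := by
    rw [depthCoeff_mul le_rfl (mem_depthSubgroup_one f) (mem_depthSubgroup_one g) (by norm_num)]
    rfl

/-- The homomorphism `f ↦ b - a²`, where `f(t) = t + a t² + b t³ + ⋯`. -/
noncomputable def quadHom (p : ℕ) [Fact p.Prime] : nottinghamGroup p →* Multiplicative (ZMod p) where
  toFun f := Multiplicative.ofAdd (depthCoeff 2 f - depthCoeff 1 f ^ 2)
  map_one' := by simp [depthCoeff_one]
  map_mul' f g := by
    rw [depthCoeff_mul (j := 1) le_rfl (mem_depthSubgroup_one f) (mem_depthSubgroup_one g)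
      (by norm_num), depthCoeff_two_mul, ← ofAdd_add]
    congr 1
    ring

/-- The first coordinate of `f` in `N/N_3 ≅ 𝔽_p²`. -/
noncomputable def lin (f : nottinghamGroup p) : ZMod p := (linHom p f).toAdd

/-- The second coordinate of `f` in `N/N_3 ≅ 𝔽_p²`. -/
noncomputable def quad (f : nottinghamGroup p) : ZMod p := (quadHom p f).toAdd

lemma lin_def (f : nottinghamGroup p) : lin f = depthCoeff 1 f := rfl
lemma quad_def (f : nottinghamGroup p) : quad f = depthCoeff 2 f - depthCoeff 1 f ^ 2 := rfl
lemma lin_mul (f g : nottinghamGroup p) : lin (f * g) = lin f + lin g := by simp [lin]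
lemma quad_mul (f g : nottinghamGroup p) : quad (f * g) = quad f + quad g := by simp [quad]
lemma lin_inv (f : nottinghamGroup p) : lin f⁻¹ = -lin f := by simp [lin]
lemma quad_inv (f : nottinghamGroup p) : quad f⁻¹ = -quad f := by simp [quad]
lemma lin_zpow (f : nottinghamGroup p) (i : ℤ) : lin (f ^ i) = i * lin f := by simp [lin]
lemma quad_zpow (f : nottinghamGroup p) (i : ℤ) : quad (f ^ i) = i * quad f := by simp [quad]
lemma lin_conj (f g : nottinghamGroup p) : lin (g⁻¹ * f * g) = lin f := by
  rw [lin_mul, lin_mul, lin_inv]; ring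
lemma quad_conj (f g : nottinghamGroup p) : quad (g⁻¹ * f * g) = quad f := by
  rw [quad_mul, quad_mul, quad_inv]; ring

lemma mem_depthSubgroup_two {f : nottinghamGroup p} : f ∈ depthSubgroup p 2 ↔ lin f = 0 := by
  rw [mem_depthSubgroup_succ, and_iff_right (mem_depthSubgroup_one f), lin_def]

lemma mem_depthSubgroup_three {f : nottinghamGroup p} :
    f ∈ depthSubgroup p 3 ↔ lin f = 0 ∧ quad f = 0 := by
  rw [mem_depthSubgroup_succ, mem_depthSubgroup_two, quad_def, lin_def]
  refine and_congr_right fun h => ?_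
  rw [h]; simp

lemma lin_quad_congr {f g : nottinghamGroup p} (h : g⁻¹ * f ∈ depthSubgroup p 3) :
    lin f = lin g ∧ quad f = quad g := by
  rw [mem_depthSubgroup_three, lin_mul, quad_mul, lin_inv, quad_inv] at h
  exact ⟨by linear_combination h.1, by linear_combination h.2⟩

/-! ### Centralizers of elements of depth one -/

lemma exists_eq_add_X_pow_three_mul (w : (ZMod p)⟦X⟧) : ∃ r, w = C (coeff 0 w) +
    C (coeff 1 w) * X + C (coeff 2 w) * X ^ 2 + X ^ 3 * r := by
  suffices h : X ^ 3 ∣ w - (C (coeff 0 w) + C (coeff 1 w) * X + C (coeff 2 w) * X ^ 2) by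
    obtain ⟨r, hr⟩ := h
    exact ⟨r, by linear_combination hr⟩
  rw [X_pow_dvd_iff]
  intro m hm
  interval_cases m <;> simp [coeff_X_pow, coeff_C]

lemma exists_apply_X_eq (f : nottinghamGroup p) : ∃ r, f.1 X = X * (1 + C (depthCoeff 1 f) * X +
    C (depthCoeff 2 f) * X ^ 2 + X ^ 3 * r) := by
  obtain ⟨w, hw⟩ := f.2
  obtain ⟨r, hr⟩ := exists_eq_add_X_pow_three_mul w
  have h : ∀ k, depthCoeff (k + 1) f = coeff k w := by
    intro k
    rw [depthCoeff, hw, mul_comm, show k + 1 + 1 = k + 2 from rfl, coeff_mul_X_pow]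
  refine ⟨C (coeff 2 w) + X * r, ?_⟩
  rw [h 0, h 1]
  linear_combination hw + X ^ 2 * hr

/-- The Frobenius identity makes `ρ ^ (d + 1)` agree with `ρ ^ 2` modulo `X ^ 3` when
`d ≡ 1` modulo an odd prime `p` and `ρ` has constant term `1`. -/
lemma exists_pow_eq_of_natCast_eq_one (hp : p ≠ 2) {d : ℕ} (hd : 1 ≤ d) (hd1 : (d : ZMod p) = 1)
    (s : (ZMod p)⟦X⟧) : ∃ σ, (1 + X * s) ^ (d + 1) = (1 + X * s) ^ 2 * (1 + X ^ 3 * σ) := by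
  have hp3 : 3 ≤ p := by have := (Fact.out : p.Prime).two_le; omega
  obtain ⟨m, hm⟩ : p ∣ d - 1 := by
    rw [← CharP.cast_eq_zero_iff (ZMod p), Nat.cast_sub hd, hd1]; simp
  obtain ⟨q, rfl⟩ := Nat.exists_eq_add_of_le hp3
  obtain ⟨t, ht⟩ : ∃ t, (1 + X * s) ^ m = 1 + X * t := by
    obtain ⟨τ, hτ⟩ := exists_one_add_pow (X * s) m
    exact ⟨(m : (ZMod (3 + q))⟦X⟧) * s + X * s ^ 2 * τ, by rw [hτ]; ring⟩
  have h2 : (1 + X * t) ^ (3 + q) = 1 + X ^ 3 * (X ^ q * t ^ (3 + q)) := by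
    have : CharP (ZMod (3 + q))⟦X⟧ (3 + q) :=
      charP_of_injective_ringHom (f := C) C_injective (3 + q)
    have : ExpChar (ZMod (3 + q))⟦X⟧ (3 + q) := ExpChar.prime Fact.out
    rw [add_pow_expChar, one_pow, mul_pow]
    ring
  refine ⟨X ^ q * t ^ (3 + q), ?_⟩
  rw [← h2, ← ht, ← pow_mul, ← pow_add]
  congr 1
  rw [mul_comm m, ← hm]
  omega

lemma mul_truncated (x a₀ a₁ a₂ a b₀ b₁ b₂ b : (ZMod p)⟦X⟧) :
    ∃ c, (a₀ + a₁ * x + a₂ * x ^ 2 + x ^ 3 * a) * (b₀ + b₁ * x + b₂ * x ^ 2 + x ^ 3 * b) =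
      a₀ * b₀ + (a₀ * b₁ + a₁ * b₀) * x + (a₀ * b₂ + a₁ * b₁ + a₂ * b₀) * x ^ 2 + x ^ 3 * c :=
  ⟨a₁ * b₂ + a₂ * b₁ + a₂ * b₂ * x + a * (b₀ + b₁ * x + b₂ * x ^ 2) +
    b * (a₀ + a₁ * x + a₂ * x ^ 2) + x ^ 3 * a * b, by ring⟩

/-- If `g ∈ N_d`, with `d ≡ 1` modulo `p` and `d ≥ 2`, commutes with `f`, then the two leading
coefficients of `g` are proportional to the coordinates of `f` in `N/N_3`. It results from
comparing `f(g(t))` and `g(f(t))` up to `t ^ (d + 3)`. -/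
lemma lin_mul_depthCoeff_succ (hp : p ≠ 2) {d : ℕ} (hd : 2 ≤ d) (hd1 : (d : ZMod p) = 1)
    {f g : nottinghamGroup p} (hg : g ∈ depthSubgroup p d) (h : f * g = g * f) :
    lin f * depthCoeff (d + 1) g = quad f * depthCoeff d g := by
  obtain ⟨e, he⟩ := hg
  have hce : ∀ k, depthCoeff (d + k) g = coeff k e := by
    intro k
    rw [depthCoeff, he, mul_comm, add_right_comm, add_comm _ k, coeff_mul_X_pow]
  have hgX : g.1 X = X + X ^ (d + 1) * e := by linear_combination he
  obtain ⟨r, hr⟩ := exists_apply_X_eq f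
  obtain ⟨e', he'⟩ := exists_eq_add_X_pow_three_mul e
  have hc0 := hce 0
  have hc1 := hce 1
  rw [add_zero] at hc0
  rw [lin_def, quad_def, hc0, hc1]
  generalize depthCoeff 1 f = a at hr ⊢
  generalize depthCoeff 2 f = b at hr ⊢
  generalize coeff 0 e = α at he' ⊢
  generalize coeff 1 e = β at he' ⊢
  generalize coeff 2 e = γ at he'
  obtain ⟨s, hs⟩ : ∃ s, s = C a + C b * X + X ^ 2 * r := ⟨_, rfl⟩
  have hfX : f.1 X = X * (1 + X * s) := by rw [hr, hs]; ring
  obtain ⟨σ, hσ⟩ := exists_pow_eq_of_natCast_eq_one hp (by omega) hd1 s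
  obtain ⟨r', hr'⟩ := X_pow_dvd_map_sub g.1 ⟨e, he⟩ r
  have hgr : g.1 r = r + X ^ (d + 1) * r' := by linear_combination hr'
  have hfe : f.1 e = C α + C β * (X * (1 + X * s)) + C γ * (X * (1 + X * s)) ^ 2 +
      (X * (1 + X * s)) ^ 3 * f.1 e' := by
    conv_lhs => rw [he']
    simp only [map_add, map_mul, map_pow, map_C, hfX]
  have h1 : f.1 (g.1 X) = g.1 (f.1 X) := by rw [← mul_apply_X, ← mul_apply_X, h]
  rw [hgX, map_add, map_mul, map_pow, hr] at h1
  simp only [map_add, map_mul, map_pow, map_one, map_C, hgX, hgr] at h1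
  rw [show X * (1 + C a * X + C b * X ^ 2 + X ^ 3 * r) = X * (1 + X * s) by rw [hs]; ring,
    mul_pow, hσ] at h1
  obtain ⟨k, rfl⟩ := Nat.exists_eq_add_of_le hd
  -- `D` is the common factor `X ^ (d + 1)`, itself divisible by `X ^ 3`.
  obtain ⟨D, hD⟩ : ∃ D : (ZMod p)⟦X⟧, D = X ^ (2 + k + 1) := ⟨_, rfl⟩
  have hDX : D = X ^ 3 * X ^ k := by rw [hD]; ring
  have hD0 : D ≠ 0 := by rw [hD]; exact pow_ne_zero _ X_ne_zero
  rw [← hD] at h1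
  have h2 : (1 + X * s) ^ 2 * (1 + X ^ 3 * σ) * f.1 e =
      e + C a * (2 * X * e + D * e ^ 2) + C b * (3 * X ^ 2 * e + 3 * X * D * e ^ 2 + D ^ 2 * e ^ 3)
      + (4 * X ^ 3 * e + 6 * X ^ 2 * D * e ^ 2 + 4 * X * D ^ 2 * e ^ 3 + D ^ 3 * e ^ 4) *
        (r + D * r') + X ^ 4 * r' := by
    apply mul_left_cancel₀ hD0
    rw [hs] at h1 ⊢
    linear_combination h1
  obtain ⟨c₁, hc₁⟩ := mul_truncated X 1 (2 * C a) (2 * C b + C a ^ 2)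
    (2 * r + 2 * C a * C b + (C b ^ 2 + 2 * C a * r) * X + 2 * C b * r * X ^ 2 + r ^ 2 * X ^ 3)
    (C α) (C β) (C γ + C a * C β) (C β * (C b + X * r) + C γ * (2 * s + X * s ^ 2) +
      (1 + X * s) ^ 3 * f.1 e')
  obtain ⟨c₂, hc₂⟩ := mul_truncated X 1 (2 * C a) (3 * C b) 0 (C α) (C β) (C γ) e'
  have h3 : X ^ 3 ∣ C (a * β - (b - a ^ 2) * α) * X ^ 2 := by
    refine ⟨c₂ - c₁ - (1 + X * s) ^ 2 * σ * f.1 e + (C a * e ^ 2 * X ^ k + C b * (3 * X * X ^ k *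
      e ^ 2 + D * X ^ k * e ^ 3) + (4 * e + 6 * X ^ 2 * X ^ k * e ^ 2 + 4 * X * D * X ^ k * e ^ 3 +
      D ^ 2 * X ^ k * e ^ 4) * (r + D * r') + X * r'), ?_⟩
    have h4 : (1 + X * s) ^ 2 * f.1 e = C α + (C β + 2 * C a * C α) * X + ((C γ + C a * C β) +
        2 * C a * C β + (2 * C b + C a ^ 2) * C α) * X ^ 2 + X ^ 3 * c₁ := by
      rw [hfe]
      rw [hs] at hc₁ ⊢
      linear_combination hc₁
    have h5 : (1 + 2 * C a * X + 3 * C b * X ^ 2) * e = C α + (C β + 2 * C a * C α) * X +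
        (C γ + 2 * C a * C β + 3 * C b * C α) * X ^ 2 + X ^ 3 * c₂ := by
      conv_lhs => rw [he']
      linear_combination hc₂
    simp only [map_sub, map_mul, map_pow]
    generalize f.1 e = fe at *
    have h6 := h2
    rw [hDX] at h6 ⊢
    linear_combination h6 - h4 + h5
  have h7 := X_pow_dvd_iff.mp h3 2 (by norm_num)
  rw [coeff_C_mul, coeff_X_pow_self, mul_one] at h7
  linear_combination h7

/-! ### The kernels of the quotients -/

lemma exists_monomial {k : ℕ} (hk : 1 ≤ k) (a : ZMod p) :
    ∃ f ∈ depthSubgroup p k, depthCoeff k f = a ∧ ∀ j ≠ k, depthCoeff j f = 0 := by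
  obtain ⟨j, rfl⟩ := Nat.exists_eq_add_of_le hk
  obtain ⟨f, hf⟩ := exists_apply_X (X ^ j * C a)
  have h : f.1 X - X = C a * X ^ (1 + j + 1) := by rw [hf]; ring
  have h2 : ∀ i, depthCoeff i f = if i = 1 + j then a else 0 := by
    intro i
    simp [depthCoeff, h, coeff_X_pow]
  refine ⟨f, mem_depthSubgroup_iff.mpr fun i hi => ?_, ?_, fun i hi => ?_⟩
  · rw [h2, if_neg hi.ne]
  · rw [h2, if_pos rfl]
  · rw [h2, if_neg hi]

lemma relIndex_eq_of_surjOn {G : Type*} [Group G] {K H : Subgroup G} (χ : G → ZMod p)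
    (hmul : ∀ f ∈ H, ∀ g ∈ H, χ (f * g) = χ f + χ g) (hsurj : ∀ a, ∃ f ∈ H, χ f = a)
    (hker : ∀ f ∈ H, f ∈ K ↔ χ f = 0) : K.relIndex H = p := by
  let φ : H →* Multiplicative (ZMod p) :=
    MonoidHom.mk' (fun f => Multiplicative.ofAdd (χ f)) fun f g => by
      rw [Subgroup.coe_mul, hmul f f.2 g g.2, ofAdd_add]
  have hφ : Function.Surjective φ := by
    intro a
    obtain ⟨f, hf, hfa⟩ := hsurj a.toAdd
    exact ⟨⟨f, hf⟩, congrArg Multiplicative.ofAdd hfa⟩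
  have hk : K.subgroupOf H = φ.ker := by
    ext f
    rw [Subgroup.mem_subgroupOf, hker f f.2, MonoidHom.mem_ker]
    rfl
  rw [Subgroup.relIndex, hk, Subgroup.index_ker, MonoidHom.range_eq_top.mpr hφ,
    Nat.card_congr Subgroup.topEquiv.toEquiv]
  exact (Nat.card_congr Multiplicative.toAdd).trans (Nat.card_zmod p)

lemma index_depthSubgroup (k : ℕ) : (depthSubgroup p (k + 1)).index = p ^ k := by
  induction k with
  | zero =>
    rw [pow_zero, Subgroup.index_eq_one, eq_top_iff]
    exact fun f _ => mem_depthSubgroup_one f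
  | succ k ih =>
    rw [← Subgroup.relIndex_mul_index (depthSubgroup_anti (Nat.le_succ (k + 1))), ih, pow_succ',
      relIndex_eq_of_surjOn (depthCoeff (k + 1))]
    · exact fun f hf g hg => depthCoeff_mul (by omega) hf hg (by omega)
    · intro a
      obtain ⟨f, hf, hfa, -⟩ := exists_monomial (k := k + 1) (by omega) a
      exact ⟨f, hf, hfa⟩
    · intro f hf
      rw [mem_depthSubgroup_succ, and_iff_right hf]

/-- For `n ≡ 1` modulo `p`, the subgroup between `N_n` and `N_{n+2}` of the elements whose
coefficients at depths `n` and `n + 1` agree. -/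
def diagonalSubgroup (p : ℕ) [Fact p.Prime] (n : ℕ) (hn : 2 ≤ n) :
    Subgroup (nottinghamGroup p) where
  carrier := {f | f ∈ depthSubgroup p n ∧ depthCoeff (n + 1) f = depthCoeff n f}
  one_mem' := ⟨one_mem _, by rw [depthCoeff_one, depthCoeff_one]⟩
  mul_mem' := by
    rintro f g ⟨hf, hf'⟩ ⟨hg, hg'⟩
    refine ⟨mul_mem hf hg, ?_⟩
    rw [depthCoeff_mul (by omega) hf hg (by omega), depthCoeff_mul (by omega) hf hg (by omega),
      hf', hg']
  inv_mem' := by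
    rintro f ⟨hf, hf'⟩
    refine ⟨inv_mem hf, ?_⟩
    rw [depthCoeff_inv (by omega) hf (by omega), depthCoeff_inv (by omega) hf (by omega), hf']

/-- The subgroup `W` of index `p ^ n` whose quotient will be shown to be a Beauville group:
`N_{n+1}` if `n ≢ 1` modulo `p`, the diagonal subgroup at depth `n` if `n ≡ 1`. -/
structure IsBeauvilleKernel (W : Subgroup (nottinghamGroup p)) (n : ℕ) : Prop where
  index_eq : W.index = p ^ n
  le : W ≤ depthSubgroup p n
  eq_of_ne : (n : ZMod p) ≠ 1 → W = depthSubgroup p (n + 1)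
  mem_iff_of_eq : (n : ZMod p) = 1 → ∀ f ∈ depthSubgroup p n,
    f ∈ W ↔ depthCoeff (n + 1) f = depthCoeff n f

lemma exists_isBeauvilleKernel {n : ℕ} (hn : 2 ≤ n) :
    ∃ W : Subgroup (nottinghamGroup p), W.Normal ∧ IsBeauvilleKernel W n := by
  by_cases h1 : (n : ZMod p) = 1
  · refine ⟨diagonalSubgroup p n hn, ⟨?_⟩, ?_, fun f hf => hf.1, fun h => absurd h1 h,
      fun _ f hf => and_iff_right hf⟩
    · rintro f ⟨hf, hf'⟩ g
      have h2 := depthCoeff_conj (by omega) hf g⁻¹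
      rw [inv_inv] at h2
      exact ⟨(depthSubgroup_normal n).conj_mem f hf g, by rw [h2.1, h2.2 h1, hf']⟩
    · have h2 : diagonalSubgroup p n hn ≤ depthSubgroup p n := fun f hf => hf.1
      rw [← Subgroup.relIndex_mul_index h2]
      obtain ⟨m, rfl⟩ : ∃ m, n = m + 1 := ⟨n - 1, by omega⟩
      rw [index_depthSubgroup, pow_succ',
        relIndex_eq_of_surjOn fun f => depthCoeff (m + 1 + 1) f - depthCoeff (m + 1) f]
      · intro f hf g hg
        rw [depthCoeff_mul (by omega) hf hg (by omega),
          depthCoeff_mul (by omega) hf hg (by omega)]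
        ring
      · intro a
        obtain ⟨f, hf, hfa, hf'⟩ := exists_monomial (k := m + 1 + 1) (by omega) a
        exact ⟨f, depthSubgroup_anti (by omega) hf, by rw [hfa, hf' _ (by omega), sub_zero]⟩
      · intro f hf
        rw [sub_eq_zero]
        exact and_iff_right hf
  · refine ⟨depthSubgroup p (n + 1), depthSubgroup_normal _, index_depthSubgroup n,
      depthSubgroup_anti (Nat.le_succ n), fun _ => rfl, fun h => absurd h h1⟩

namespace IsBeauvilleKernel

variable {W : Subgroup (nottinghamGroup p)} {n : ℕ}

lemma le_succ (hW : IsBeauvilleKernel W n) {m : ℕ} (hm : m ≤ n + 1)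
    (h : (n : ZMod p) = 1 → m ≤ n) : W ≤ depthSubgroup p m := by
  by_cases h1 : (n : ZMod p) = 1
  · exact hW.le.trans (depthSubgroup_anti (h h1))
  · rw [hW.eq_of_ne h1]
    exact depthSubgroup_anti hm

lemma depthSubgroup_le (hW : IsBeauvilleKernel W n) : depthSubgroup p (n + 2) ≤ W := by
  by_cases h1 : (n : ZMod p) = 1
  · intro f hf
    rw [hW.mem_iff_of_eq h1 f (depthSubgroup_anti (by omega) hf),
      depthCoeff_eq_zero hf (by omega), depthCoeff_eq_zero hf (by omega)]
  · rw [hW.eq_of_ne h1]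
    exact depthSubgroup_anti (by omega)

lemma le_three (hW : IsBeauvilleKernel W n) (hn : 2 ≤ n) :
    W ≤ depthSubgroup p 3 := by
  refine hW.le_succ (by omega) fun h1 => ?_
  by_contra h
  obtain rfl : n = 2 := by omega
  have : (1 : ZMod p) = 0 := by push_cast at h1; linear_combination h1
  exact one_ne_zero this

end IsBeauvilleKernel

/-! ### Generation -/

lemma exists_zpow_mem_of_ne_zero {k : ℕ} (hk : 1 ≤ k) {f c : nottinghamGroup p}
    (hf : f ∈ depthSubgroup p k) (hc : c ∈ depthSubgroup p k) (hc0 : depthCoeff k c ≠ 0) :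
    ∃ i : ℕ, (c ^ i)⁻¹ * f ∈ depthSubgroup p (k + 1) := by
  have hpow : ∀ i : ℕ, depthCoeff k (c ^ i) = i * depthCoeff k c := by
    intro i
    induction i with
    | zero => simp [depthCoeff_one]
    | succ i ih =>
      rw [pow_succ, depthCoeff_mul hk (pow_mem hc i) hc (by omega), ih]
      push_cast; ring
  refine ⟨(depthCoeff k f / depthCoeff k c).val, ?_⟩
  rw [mem_depthSubgroup_succ]
  refine ⟨mul_mem (inv_mem (pow_mem hc _)) hf, ?_⟩
  rw [depthCoeff_mul hk (inv_mem (pow_mem hc _)) hf (by omega),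
    depthCoeff_inv hk (pow_mem hc _) (by omega), hpow, ZMod.natCast_zmod_val]
  field_simp
  ring

lemma commutator_mem {i j : ℕ} (hi : 1 ≤ i) (hj : 1 ≤ j) {f g : nottinghamGroup p}
    (hf : f ∈ depthSubgroup p i) (hg : g ∈ depthSubgroup p j) :
    (g * f)⁻¹ * (f * g) ∈ depthSubgroup p (i + j) := by
  rw [inv_mul_mem_depthSubgroup, mul_apply_X, mul_apply_X]
  have h := dvd_add ((pow_dvd_pow X (Nat.le_succ _)).trans (X_pow_dvd_comm hi hj hf hg))
    (Dvd.intro_left (C (((j : ZMod p) - i) * depthCoeff i f * depthCoeff j g)) rfl)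
  simpa only [sub_add_cancel] using h

/-- Elements of depths `i` and `j` with `i ≢ j` modulo `p` have a commutator of depth exactly
`i + j`. -/
lemma depthCoeff_commutator_ne_zero {i j : ℕ} (hi : 1 ≤ i) (hj : 1 ≤ j)
    (hij : (j : ZMod p) ≠ i) {f g : nottinghamGroup p} (hf : f ∈ depthSubgroup p i)
    (hg : g ∈ depthSubgroup p j) (hf0 : depthCoeff i f ≠ 0) (hg0 : depthCoeff j g ≠ 0) :
    depthCoeff (i + j) ((g * f)⁻¹ * (f * g)) ≠ 0 := by
  intro h2
  have h := X_pow_dvd_comm hi hj hf hg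
  have h3 := mem_depthSubgroup_succ.mpr ⟨commutator_mem hi hj hf hg, h2⟩
  rw [inv_mul_mem_depthSubgroup, mul_apply_X, mul_apply_X] at h3
  have h4 := X_pow_dvd_iff.mp (dvd_sub h3 h) (i + j + 1) (Nat.lt_succ_self _)
  rw [sub_sub_cancel, coeff_C_mul, coeff_X_pow_self, mul_one] at h4
  exact mul_ne_zero (mul_ne_zero (sub_ne_zero.mpr hij) hf0) hg0 h4

/-- Two elements independent modulo `N_3` generate the Nottingham group topologically. -/
lemma eq_top_of_mem (hp : p ≠ 2) {H : Subgroup (nottinghamGroup p)} {x y : nottinghamGroup p}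
    (hx : x ∈ H) (hy : y ∈ H) (hxy : lin x * quad y - lin y * quad x ≠ 0) {k : ℕ}
    (hk : depthSubgroup p k ≤ H) : H = ⊤ := by
  suffices h : ∀ m, 3 ≤ m → ∀ f, ∃ g ∈ H, g⁻¹ * f ∈ depthSubgroup p m by
    rw [eq_top_iff]
    intro f _
    obtain ⟨g, hg, hgf⟩ := h (k + 3) (by omega) f
    simpa using mul_mem hg (hk (depthSubgroup_anti (Nat.le_add_right k 3) hgf))
  intro m hm
  induction m, hm using Nat.le_induction with
  | base =>
    intro f
    -- Cramer's rule in `N/N_3`.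
    set D := lin x * quad y - lin y * quad x
    refine ⟨x ^ ((((lin f * quad y - lin y * quad f) / D).val : ℕ) : ℤ) *
      y ^ ((((lin x * quad f - lin f * quad x) / D).val : ℕ) : ℤ),
      mul_mem (zpow_mem hx _) (zpow_mem hy _), ?_⟩
    rw [mem_depthSubgroup_three]
    simp only [lin_mul, lin_inv, lin_zpow, quad_mul, quad_inv, quad_zpow, Int.cast_natCast,
      ZMod.natCast_zmod_val]
    constructor
    · field_simp
      simp only [D]; ring
    · field_simp
      simp only [D]; ring
  | succ m hm ih =>
    intro f
    obtain ⟨g, hg, hgf⟩ := ih f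
    obtain ⟨i, hi, him, hne⟩ : ∃ i, 1 ≤ i ∧ i < m ∧ ((m - i : ℕ) : ZMod p) ≠ i := by
      by_cases h : ((m - 1 : ℕ) : ZMod p) = (1 : ℕ)
      · refine ⟨2, by omega, by omega, fun h2 => ?_⟩
        rw [Nat.cast_sub (by omega)] at h h2
        push_cast at h h2
        have h3 : (2 : ZMod p) = 0 := by linear_combination h - h2
        have h4 : p ∣ 2 := (CharP.cast_eq_zero_iff (ZMod p) p 2).mp (by exact_mod_cast h3)
        exact hp ((Nat.prime_dvd_prime_iff_eq Fact.out Nat.prime_two).mp h4)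
      · exact ⟨1, le_rfl, by omega, h⟩
    have hlift : ∀ j, 1 ≤ j → j < m → ∃ c ∈ H, c ∈ depthSubgroup p j ∧ depthCoeff j c ≠ 0 := by
      intro j hj hjm
      obtain ⟨t, ht, ht1, -⟩ := exists_monomial (p := p) hj 1
      obtain ⟨c, hc, hct⟩ := ih t
      refine ⟨c, hc, ?_, ?_⟩
      · have := mul_mem ht (inv_mem (depthSubgroup_anti hjm.le hct))
        simpa using this
      · rw [← depthCoeff_congr hct hjm, ht1]
        exact one_ne_zero
    obtain ⟨a, haH, ha, ha0⟩ := hlift i hi him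
    obtain ⟨b, hbH, hb, hb0⟩ := hlift (m - i) (by omega) (by omega)
    have h1 := commutator_mem hi (by omega) ha hb
    have h2 := depthCoeff_commutator_ne_zero hi (by omega) hne ha hb ha0 hb0
    rw [show i + (m - i) = m by omega] at h1 h2
    obtain ⟨l, hl⟩ := exists_zpow_mem_of_ne_zero (by omega) hgf h1 h2
    refine ⟨g * ((b * a)⁻¹ * (a * b)) ^ l, mul_mem hg (pow_mem (mul_mem (inv_mem
      (mul_mem hbH haH)) (mul_mem haH hbH)) _), ?_⟩
    rwa [mul_inv_rev, mul_assoc]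

/-! ### Conjugates of cyclic subgroups -/

/-- In the quotient by `W`, no nontrivial power of the image of `f` is conjugate to a power of the
image of `f'`. -/
def MeetsTrivially (W : Subgroup (nottinghamGroup p)) (f f' : nottinghamGroup p) : Prop :=
  ∀ (i j : ℤ) (g : nottinghamGroup p), (f' ^ j)⁻¹ * (g⁻¹ * f ^ i * g) ∈ W → f ^ i ∈ W

lemma MeetsTrivially.inv_left {W : Subgroup (nottinghamGroup p)} {f f' : nottinghamGroup p}
    (h : MeetsTrivially W f f') : MeetsTrivially W f⁻¹ f' := by
  intro i j g hi
  rw [inv_zpow'] at hi ⊢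
  exact h _ _ _ hi

lemma closure_mk_eq_top {W : Subgroup (nottinghamGroup p)} [W.Normal] {x y : nottinghamGroup p}
    (h : ∀ H : Subgroup (nottinghamGroup p), W ≤ H → x ∈ H → y ∈ H → H = ⊤) :
    Subgroup.closure {(x : nottinghamGroup p ⧸ W), (y : nottinghamGroup p ⧸ W)} = ⊤ := by
  have h1 := h ((Subgroup.closure {(x : nottinghamGroup p ⧸ W), (y : nottinghamGroup p ⧸ W)}).comap
    (QuotientGroup.mk' W)) ?_ ?_ ?_
  · rw [eq_top_iff]
    intro z _
    obtain ⟨z, rfl⟩ := QuotientGroup.mk'_surjective W z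
    have h2 : z ∈ (⊤ : Subgroup (nottinghamGroup p)) := Subgroup.mem_top z
    rwa [← h1] at h2
  · intro w hw
    rw [Subgroup.mem_comap, QuotientGroup.mk'_apply, (QuotientGroup.eq_one_iff w).mpr hw]
    exact one_mem _
  · exact Subgroup.subset_closure (Set.mem_insert _ _)
  · exact Subgroup.subset_closure (Set.mem_insert_of_mem _ rfl)

lemma exists_of_mem_beauvilleSigma {W : Subgroup (nottinghamGroup p)} [W.Normal]
    {x y : nottinghamGroup p} {z : nottinghamGroup p ⧸ W}
    (hz : z ∈ beauvilleSigma (x : nottinghamGroup p ⧸ W) (y : nottinghamGroup p ⧸ W)) :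
    ∃ f, (f = x ∨ f = y ∨ f = x * y) ∧ ∃ (i : ℤ) (g : nottinghamGroup p),
      z = ((g⁻¹ * f ^ i * g : nottinghamGroup p) : nottinghamGroup p ⧸ W) := by
  obtain ⟨g, w, hw, rfl⟩ := hz
  obtain ⟨g, rfl⟩ := QuotientGroup.mk_surjective g
  rcases hw with ⟨i, rfl⟩ | ⟨i, rfl⟩ | ⟨i, rfl⟩
  · exact ⟨x, Or.inl rfl, i, g, rfl⟩
  · exact ⟨y, Or.inr (Or.inl rfl), i, g, rfl⟩
  · exact ⟨x * y, Or.inr (Or.inr rfl), i, g, rfl⟩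

lemma isBeauvilleGroup_quotient {W : Subgroup (nottinghamGroup p)} [W.Normal] (hW : W.index ≠ 0)
    {x₁ y₁ x₂ y₂ : nottinghamGroup p}
    (h₁ : ∀ H : Subgroup (nottinghamGroup p), W ≤ H → x₁ ∈ H → y₁ ∈ H → H = ⊤)
    (h₂ : ∀ H : Subgroup (nottinghamGroup p), W ≤ H → x₂ ∈ H → y₂ ∈ H → H = ⊤)
    (h : ∀ f, (f = x₁ ∨ f = y₁ ∨ f = x₁ * y₁) → ∀ f', (f' = x₂ ∨ f' = y₂ ∨ f' = x₂ * y₂) →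
      MeetsTrivially W f f') : IsBeauvilleGroup (nottinghamGroup p ⧸ W) := by
  refine ⟨Nat.finite_of_card_ne_zero hW, x₁, y₁, x₂, y₂, closure_mk_eq_top h₁,
    closure_mk_eq_top h₂, ?_⟩
  apply Set.eq_of_subset_of_subset
  · rintro z ⟨hz₁, hz₂⟩
    obtain ⟨f, hf, i, g, rfl⟩ := exists_of_mem_beauvilleSigma hz₁
    obtain ⟨f', hf', j, g', hz⟩ := exists_of_mem_beauvilleSigma hz₂
    have h1 : (f' ^ j)⁻¹ * ((g * g'⁻¹)⁻¹ * f ^ i * (g * g'⁻¹)) ∈ W := by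
      rw [← QuotientGroup.eq]
      have h2 : f' ^ j = g' * (g'⁻¹ * f' ^ j * g') * g'⁻¹ := by group
      rw [h2, QuotientGroup.mk_mul, QuotientGroup.mk_mul, ← hz]
      simp only [← QuotientGroup.mk_mul]
      exact congrArg _ (by group)
    have h3 := h f hf f' hf' i j _ h1
    rw [Set.mem_singleton_iff, QuotientGroup.eq_one_iff]
    simpa using Subgroup.Normal.conj_mem ‹W.Normal› _ h3 g⁻¹
  · rintro z rfl
    exact ⟨⟨1, 1, Or.inl (one_mem _), by simp⟩, ⟨1, 1, Or.inl (one_mem _), by simp⟩⟩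

lemma exists_depth {m : ℕ} {f : nottinghamGroup p} (hf : f ∉ depthSubgroup p m) :
    ∃ d, 1 ≤ d ∧ d < m ∧ f ∈ depthSubgroup p d ∧ depthCoeff d f ≠ 0 := by
  induction m with
  | zero => exact absurd (depthSubgroup_anti (Nat.zero_le 1) (mem_depthSubgroup_one f)) hf
  | succ m ih =>
    by_cases h : f ∈ depthSubgroup p m
    · rw [mem_depthSubgroup_succ, and_iff_right h] at hf
      refine ⟨m, ?_, Nat.lt_succ_self m, h, hf⟩
      by_contra h0
      obtain rfl : m = 0 := by omega
      exact hf (depthCoeff_eq_zero (mem_depthSubgroup_one f) one_pos)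
    · obtain ⟨d, h1, h2, h3⟩ := ih h
      exact ⟨d, h1, by omega, h3⟩

/-- An element `u` of direction `(1, 1)` modulo `N_3` against any element `v` of another direction:
the two leading coefficients of a power of `u` that survives in `N/W` are equal and still visible
there, while those of a power of `v` are in another proportion. -/
lemma meetsTrivially_of_quad_eq_lin (hp : p ≠ 2) {W : Subgroup (nottinghamGroup p)} {n : ℕ}
    (hn : 2 ≤ n) (hW : IsBeauvilleKernel W n) {u v : nottinghamGroup p} (hu0 : lin u ≠ 0)
    (hu : quad u = lin u) (hv : quad v ≠ lin v) : MeetsTrivially W u v := by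
  intro i j g h
  by_contra hi
  have hcomm : u * u ^ i = u ^ i * u := (Commute.self_zpow u i).eq
  have hmod : ∀ d, 1 ≤ d → u ^ i ∈ depthSubgroup p d → depthCoeff d (u ^ i) ≠ 0 →
      (d : ZMod p) = 1 := by
    intro d hd h1 h2
    simpa using natCast_eq_of_commute le_rfl hd (mem_depthSubgroup_one u) hu0 h1 h2 hcomm
  have hslope : ∀ d, 2 ≤ d → u ^ i ∈ depthSubgroup p d → (d : ZMod p) = 1 →
      depthCoeff (d + 1) (u ^ i) = depthCoeff d (u ^ i) := by
    intro d hd h1 hd1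
    have := lin_mul_depthCoeff_succ hp hd hd1 h1 hcomm
    rw [hu] at this
    exact mul_left_cancel₀ hu0 this
  obtain ⟨d, hd, hd1, hid, hid0, hWd⟩ : ∃ d : ℕ, 1 ≤ d ∧ (d : ZMod p) = 1 ∧
      u ^ i ∈ depthSubgroup p d ∧ depthCoeff d (u ^ i) ≠ 0 ∧ W ≤ depthSubgroup p (d + 2) := by
    by_cases hn1 : (n : ZMod p) = 1
    · have hin : u ^ i ∉ depthSubgroup p n := fun h1 =>
        hi ((hW.mem_iff_of_eq hn1 _ h1).mpr (hslope n hn h1 hn1))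
      obtain ⟨d, hd, hdn, hid, hid0⟩ := exists_depth hin
      have hd1 := hmod d hd hid hid0
      refine ⟨d, hd, hd1, hid, hid0, hW.le.trans (depthSubgroup_anti ?_)⟩
      by_contra hlt
      obtain rfl : n = d + 1 := by omega
      rw [Nat.cast_add, hd1, Nat.cast_one] at hn1
      exact one_ne_zero (α := ZMod p) (by linear_combination hn1)
    · have hW' := hW.eq_of_ne hn1
      obtain ⟨d, hd, hdn, hid, hid0⟩ := exists_depth (hW' ▸ hi)
      have hd1 := hmod d hd hid hid0
      refine ⟨d, hd, hd1, hid, hid0, hW'.le.trans (depthSubgroup_anti ?_)⟩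
      by_contra hlt
      obtain rfl : n = d := by omega
      exact hn1 hd1
  have hcongr : ∀ k < d + 2, depthCoeff k (g⁻¹ * u ^ i * g) = depthCoeff k (v ^ j) :=
    fun k hk => depthCoeff_congr (hWd h) hk
  obtain ⟨hc, hc'⟩ := depthCoeff_conj hd hid g
  obtain rfl | hd2 := hd.eq_or_lt
  · have h1 := lin_quad_congr (hWd h)
    rw [lin_conj, quad_conj, lin_zpow, quad_zpow, lin_zpow, quad_zpow, hu] at h1
    have h2 : (j : ZMod p) * (quad v - lin v) = 0 := by linear_combination h1.1 - h1.2
    have h3 := (mul_eq_zero.mp h2).resolve_right (sub_ne_zero.mpr hv)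
    rw [← lin_def, lin_zpow, h1.1, h3, zero_mul] at hid0
    exact hid0 rfl
  · have hvd : v ^ j ∈ depthSubgroup p d := by
      rw [mem_depthSubgroup_iff]
      intro k hk
      rw [← hcongr k (by omega)]
      exact depthCoeff_eq_zero (by simpa using (depthSubgroup_normal d).conj_mem _ hid g⁻¹) hk
    have h1 := lin_mul_depthCoeff_succ hp hd2 hd1 hvd (Commute.self_zpow v j).eq
    rw [← hcongr _ (by omega), ← hcongr _ (by omega), hc, hc' hd1, hslope d hd2 hid hd1] at h1
    exact hv (mul_right_cancel₀ hid0 h1).symm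

lemma zpow_eq_one_of_cast_eq_zero {f : nottinghamGroup p} (hf : f ^ p = 1) {i : ℤ}
    (hi : (i : ZMod p) = 0) : f ^ i = 1 := by
  obtain ⟨k, rfl⟩ := (ZMod.intCast_zmod_eq_zero_iff_dvd i p).mp hi
  rw [zpow_mul, zpow_natCast, hf, one_zpow]

lemma meetsTrivially_of_pow_eq_one {W : Subgroup (nottinghamGroup p)}
    (hW : W ≤ depthSubgroup p 3) {f v : nottinghamGroup p} (hf : f ^ p = 1)
    (hfv : lin f * quad v - lin v * quad f ≠ 0) : MeetsTrivially W f v := by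
  intro i j g h
  have h1 := lin_quad_congr (hW h)
  rw [lin_conj, quad_conj, lin_zpow, quad_zpow, lin_zpow, quad_zpow] at h1
  have h2 : (i : ZMod p) * (lin f * quad v - lin v * quad f) = 0 := by
    linear_combination quad v * h1.1 - lin v * h1.2
  rw [zpow_eq_one_of_cast_eq_zero hf ((mul_eq_zero.mp h2).resolve_right hfv)]
  exact one_mem W

/-- Two elements `F` and `F c` of the same direction, with `F` of order `p`, generate cyclic
subgroups without common conjugate modulo `N_{k+1}` as soon as `F` and `F c` are not conjugate and
`F c` still has order `p` there. -/
lemma meetsTrivially_of_not_conj {W : Subgroup (nottinghamGroup p)} {k : ℕ} (hk : 3 ≤ k)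
    (hW : W ≤ depthSubgroup p (k + 1)) {F c : nottinghamGroup p} (hF : F ^ p = 1)
    (hF3 : F ∉ depthSubgroup p 3) (hc : c ∈ depthSubgroup p k)
    (hpow : (F * c) ^ p ∈ depthSubgroup p (k + 1))
    (hconj : ∀ h, (F * c)⁻¹ * (h⁻¹ * F * h) ∉ depthSubgroup p (k + 1)) :
    MeetsTrivially W F (F * c) := by
  intro i j g h
  have h0 := hW h
  have h1 := lin_quad_congr (depthSubgroup_anti (by omega : 3 ≤ k + 1) h0)
  have h2 := mem_depthSubgroup_three.mp (depthSubgroup_anti hk hc)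
  rw [lin_conj, quad_conj, lin_zpow, quad_zpow, lin_zpow, quad_zpow, lin_mul, quad_mul, h2.1,
    h2.2, add_zero, add_zero] at h1
  have hij : ((i - j : ℤ) : ZMod p) = 0 := by
    by_contra hne
    refine hF3 (mem_depthSubgroup_three.mpr ⟨?_, ?_⟩) <;> apply mul_left_cancel₀ hne <;>
      push_cast
    · linear_combination h1.1
    · linear_combination h1.2
  have hFij : F ^ i = F ^ j := by
    rw [← sub_add_cancel i j, zpow_add, zpow_eq_one_of_cast_eq_zero hF hij, one_mul]
  by_cases hj : (j : ZMod p) = 0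
  · rw [hFij, zpow_eq_one_of_cast_eq_zero hF hj]
    exact one_mem W
  exfalso
  -- Raising to a power `l` inverse to `j` modulo `p` makes `F c` and `F` conjugate.
  obtain ⟨l, hl⟩ : ∃ l : ℤ, (l : ZMod p) = (j : ZMod p)⁻¹ := ZMod.intCast_surjective _
  obtain ⟨s, hs⟩ : (p : ℤ) ∣ j * l - 1 := by
    rw [← ZMod.intCast_zmod_eq_zero_iff_dvd]
    push_cast
    rw [hl, mul_inv_cancel₀ hj, sub_self]
  have hjl : j * l = 1 + p * s := by linear_combination hs
  have hone : ∀ f : nottinghamGroup p, f ^ p ∈ depthSubgroup p (k + 1) →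
      ((f ^ (j * l) : nottinghamGroup p) : nottinghamGroup p ⧸ depthSubgroup p (k + 1)) = f := by
    intro f hf
    rw [hjl, zpow_add, zpow_one, zpow_mul, zpow_natCast, QuotientGroup.mk_mul,
      (QuotientGroup.eq_one_iff _).mpr (zpow_mem hf s), mul_one]
  apply hconj g
  rw [← QuotientGroup.eq] at h0 ⊢
  rw [hFij] at h0
  rw [← hone (F * c) hpow, zpow_mul, QuotientGroup.mk_zpow, h0, QuotientGroup.mk_mul,
    QuotientGroup.mk_mul, QuotientGroup.mk_mul, QuotientGroup.mk_mul, ← hone F (by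
      rw [hF]; exact one_mem _), zpow_mul, QuotientGroup.mk_inv, QuotientGroup.mk_zpow _ _ l]
  simpa using (conj_zpow (i := l) (a := (g : nottinghamGroup p ⧸ depthSubgroup p (k + 1))⁻¹)
    (b := ((F ^ j : nottinghamGroup p) : nottinghamGroup p ⧸ depthSubgroup p (k + 1))))

/-! ### Elements of order `p` -/

lemma lin_quad_of_apply_X {f : nottinghamGroup p} {a b : ZMod p} {r : (ZMod p)⟦X⟧}
    (h : f.1 X = X + C a * X ^ 2 + C b * X ^ 3 + X ^ 4 * r) : lin f = a ∧ quad f = b - a ^ 2 := by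
  have h1 : f.1 X - X = C a * X ^ 2 + C b * X ^ 3 + r * X ^ 4 := by rw [h]; ring
  have h2 : depthCoeff 1 f = a := by
    simp [depthCoeff, h1, coeff_mul_X_pow']
  have h3 : depthCoeff 2 f = b := by
    simp [depthCoeff, h1, coeff_mul_X_pow']
  rw [quad_def, lin_def, h2, h3]
  exact ⟨rfl, rfl⟩

lemma exists_lin_quad (a b : ZMod p) : ∃ f : nottinghamGroup p, lin f = a ∧ quad f = b := by
  obtain ⟨f, hf⟩ := exists_apply_X (C a + C (b + a ^ 2) * X)
  obtain ⟨h1, h2⟩ := lin_quad_of_apply_X (f := f) (a := a) (b := b + a ^ 2) (r := 0)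
    (by rw [hf]; ring)
  exact ⟨f, h1, by rw [h2]; ring⟩

lemma pow_apply_succ (f : nottinghamGroup p) (j : ℕ) :
    (f ^ (j + 1)).1 X = (f ^ j).1 (f.1 X) := by
  rw [pow_succ, mul_apply_X]

/-- The automorphism `t ↦ t / (1 - t)`, whose `j`-th power is `t ↦ t / (1 - j t)`. -/
lemma exists_pow_eq_one_lin : ∃ f : nottinghamGroup p, f ^ p = 1 ∧ lin f = 1 ∧ quad f = 0 := by
  obtain ⟨v, hv⟩ : ∃ v : (ZMod p)⟦X⟧, v * (1 - X) = 1 := ⟨_, mk_one_mul_one_sub_eq_one _⟩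
  obtain ⟨f, hf⟩ := exists_apply_X v
  have h1 : (1 - X) * f.1 X = X := by rw [hf]; linear_combination X ^ 2 * hv
  have h2 : ∀ j : ℕ, (1 - (j : (ZMod p)⟦X⟧) * X) * (f ^ j).1 X = X := by
    intro j
    induction j with
    | zero => simp
    | succ j ih =>
      have h3 := congrArg (f ^ j).1 h1
      rw [map_mul, map_sub, map_one] at h3
      rw [pow_apply_succ]
      push_cast
      linear_combination (1 - (j : (ZMod p)⟦X⟧) * X) * h3 + (1 + (f ^ j).1 (f.1 X)) * ih
  refine ⟨f, ext_X ?_, ?_⟩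
  · have h3 := h2 p
    have hp0 : (p : (ZMod p)⟦X⟧) = 0 := by
      rw [← map_natCast (C (R := ZMod p)), CharP.cast_eq_zero, map_zero]
    rw [hp0] at h3
    simpa using h3
  · obtain ⟨h3, h4⟩ := lin_quad_of_apply_X (f := f) (a := 1) (b := 1) (r := v)
      (by rw [hf, map_one]; linear_combination (X ^ 2 + X ^ 3) * hv)
    exact ⟨h3, by rw [h4]; ring⟩

/-- The automorphism `t ↦ t / (1 - 2 t²) ^ (1/2)`, whose `j`-th power is
`t ↦ t / (1 - 2 j t²) ^ (1/2)`. -/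
lemma exists_pow_eq_one_quad (hp : p ≠ 2) :
    ∃ f : nottinghamGroup p, f ^ p = 1 ∧ lin f = 0 ∧ quad f = 1 := by
  have h20 : (2 : ZMod p) ≠ 0 := by
    intro h
    have h4 : p ∣ 2 := (CharP.cast_eq_zero_iff (ZMod p) p 2).mp (by exact_mod_cast h)
    exact hp ((Nat.prime_dvd_prime_iff_eq Fact.out Nat.prime_two).mp h4)
  obtain ⟨c, hc⟩ : ∃ c : (ZMod p)⟦X⟧, 2 * c = 1 :=
    ⟨C 2⁻¹, by rw [← map_ofNat (C (R := ZMod p)), ← map_mul, mul_inv_cancel₀ h20, map_one]⟩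
  obtain ⟨w, hw⟩ : ∃ w : (ZMod p)⟦X⟧, (1 - 2 * X ^ 2) * w = 1 := by
    have h : IsUnit (1 - 2 * X ^ 2 : (ZMod p)⟦X⟧) := by
      rw [isUnit_iff_constantCoeff]; simp
    exact h.exists_right_inv
  -- `1 + X ^ 2 q` is a square root of `w = 1 / (1 - 2 X ^ 2)`.
  obtain ⟨q, hq⟩ := exists_fixedPoint (fun q => w - c * X ^ 2 * q ^ 2) (by
    rintro m a b ⟨d, hd⟩
    exact ⟨-(c * X * (a + b) * d), by linear_combination -(c * X ^ 2 * (a + b)) * hd⟩)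
  have hsq : (1 + X ^ 2 * q) ^ 2 = w := by
    linear_combination -2 * X ^ 2 * hq - X ^ 4 * q ^ 2 * hc - hw
  obtain ⟨f, hf⟩ := exists_apply_X (X * q)
  have hfX : f.1 X = X * (1 + X ^ 2 * q) := by rw [hf]; ring
  have h1 : f.1 X ^ 2 * (1 - 2 * X ^ 2) = X ^ 2 := by
    rw [hfX]; linear_combination X ^ 2 * hw + X ^ 2 * (1 - 2 * X ^ 2) * hsq
  have h2 : ∀ j : ℕ, (1 - 2 * (j : (ZMod p)⟦X⟧) * X ^ 2) * (f ^ j).1 X ^ 2 = X ^ 2 := by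
    intro j
    induction j with
    | zero => simp
    | succ j ih =>
      have h3 := congrArg (f ^ j).1 h1
      simp only [map_mul, map_sub, map_one, map_pow, map_ofNat] at h3
      rw [pow_apply_succ]
      push_cast
      linear_combination (1 - 2 * (j : (ZMod p)⟦X⟧) * X ^ 2) * h3 +
        (1 + 2 * (f ^ j).1 (f.1 X) ^ 2) * ih
  refine ⟨f, ext_X ?_, ?_⟩
  · have h3 := h2 p
    have hp0 : (p : (ZMod p)⟦X⟧) = 0 := by
      rw [← map_natCast (C (R := ZMod p)), CharP.cast_eq_zero, map_zero]
    rw [hp0] at h3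
    have h4 : (f ^ p).1 X ^ 2 = X ^ 2 := by linear_combination h3
    obtain h5 | h5 := sq_eq_sq_iff_eq_or_eq_neg.mp h4
    · exact h5
    · exfalso
      have h6 := X_pow_dvd_iff.mp (f ^ p).2 1 one_lt_two
      rw [h5, map_sub, map_neg, coeff_one_X] at h6
      exact h20 (by linear_combination -h6)
  · obtain ⟨h3, h4⟩ := lin_quad_of_apply_X (f := f) (a := 0) (b := 1)
      (r := X * (2 * w - c * q ^ 2)) (by
        rw [hf, map_one, map_zero]; linear_combination X ^ 3 * hw - X ^ 3 * hq)
    exact ⟨h3, by rw [h4]; ring⟩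

/-! ### Non-conjugate elements of the same direction for `p = 3` -/

lemma commutator_pow_mul (F h : nottinghamGroup p) (l : ℕ) :
    (h * F)⁻¹ * (F * h) = ((F ^ l)⁻¹ * h * F)⁻¹ * (F * ((F ^ l)⁻¹ * h)) := by
  have h1 : F * (F ^ l)⁻¹ = (F ^ l)⁻¹ * F := ((Commute.refl F).pow_right l).inv_right.eq
  rw [← mul_assoc F, h1]
  group

/-- For `p = 3`, no commutator with an element of depth `1` has depth exactly `5`. -/
lemma depthCoeff_five_commutator {F h : nottinghamGroup 3} (hF : lin F ≠ 0)
    (h5 : (h * F)⁻¹ * (F * h) ∈ depthSubgroup 3 5) :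
    depthCoeff 5 ((h * F)⁻¹ * (F * h)) = 0 := by
  -- Multiplication by a power of `F` brings `h` into `N_2`; it then lies in `N_4`.
  obtain ⟨l, hl⟩ := exists_zpow_mem_of_ne_zero le_rfl (mem_depthSubgroup_one h)
    (mem_depthSubgroup_one F) hF
  rw [commutator_pow_mul F h l] at h5 ⊢
  generalize (F ^ l)⁻¹ * h = h' at *
  have key : ∀ j, 2 ≤ j → j < 4 → h' ∈ depthSubgroup 3 j → h' ∈ depthSubgroup 3 (j + 1) := by
    intro j hj hj4 hh
    rw [mem_depthSubgroup_succ, and_iff_right hh]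
    by_contra h0
    refine depthCoeff_commutator_ne_zero le_rfl (by omega) ?_ (mem_depthSubgroup_one F) hh hF h0
      (depthCoeff_eq_zero h5 (by omega))
    interval_cases j <;> decide
  have h4 := key 3 (by norm_num) (by norm_num) (key 2 le_rfl (by norm_num) hl)
  have h6 := inv_mem ((conj_inv_mul_mem (by norm_num) h4 F).2 (by decide))
  refine depthCoeff_eq_zero (k := 6) ?_ (by norm_num)
  convert h6 using 1
  group

/-- For `p = 3`, no commutator with an element of depth `2` has depth exactly `4`. -/
lemma depthCoeff_four_commutator {F h : nottinghamGroup 3} (hF : lin F = 0) (hF2 : quad F ≠ 0)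
    (h4 : (h * F)⁻¹ * (F * h) ∈ depthSubgroup 3 4) :
    depthCoeff 4 ((h * F)⁻¹ * (F * h)) = 0 := by
  have hF' := mem_depthSubgroup_two.mpr hF
  have hF0 : depthCoeff 2 F ≠ 0 := by
    rw [quad_def, ← lin_def, hF] at hF2
    simpa using hF2
  have hh : h ∈ depthSubgroup 3 2 := by
    rw [mem_depthSubgroup_succ, and_iff_right (mem_depthSubgroup_one h)]
    by_contra h0
    exact depthCoeff_commutator_ne_zero (by norm_num) le_rfl (by decide) hF'
      (mem_depthSubgroup_one h) hF0 h0 (depthCoeff_eq_zero h4 (by norm_num))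
  obtain ⟨l, hl⟩ := exists_zpow_mem_of_ne_zero (by norm_num) hh hF' hF0
  rw [commutator_pow_mul F h l]
  exact depthCoeff_eq_zero (commutator_mem (by norm_num) (by norm_num) hF' hl) (by norm_num)

lemma mul_pow_mem {k : ℕ} {F c : nottinghamGroup p} (hF : F ^ p = 1)
    (hc : c ∈ depthSubgroup p k) : (F * c) ^ p ∈ depthSubgroup p k := by
  rw [← QuotientGroup.eq_one_iff, QuotientGroup.mk_pow, QuotientGroup.mk_mul,
    (QuotientGroup.eq_one_iff c).mpr hc, mul_one, ← QuotientGroup.mk_pow, hF,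
    QuotientGroup.mk_one]

/-- Multiplying `F`, of depth exactly `i` and order `p`, by `c` of depth exactly `k ≢ i` gives an
element none of whose powers is conjugate to a nontrivial power of `F` modulo `N_{k+1}`, provided commutators with `F` never have depth exactly
`k`. -/
lemma meetsTrivially_mul {W : Subgroup (nottinghamGroup p)} {i k : ℕ} (hi : 1 ≤ i) (hi3 : i < 3)
    (hk : 3 ≤ k) (hki : (k : ZMod p) ≠ i) (hW : W ≤ depthSubgroup p (k + 1))
    {F c : nottinghamGroup p} (hF : F ^ p = 1) (hFi : F ∈ depthSubgroup p i)
    (hFi0 : depthCoeff i F ≠ 0) (hc : c ∈ depthSubgroup p k) (hc0 : depthCoeff k c ≠ 0)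
    (hcomm : ∀ h : nottinghamGroup p, (h * F)⁻¹ * (F * h) ∈ depthSubgroup p k →
      depthCoeff k ((h * F)⁻¹ * (F * h)) = 0) : MeetsTrivially W F (F * c) := by
  refine meetsTrivially_of_not_conj hk hW hF (fun h => hFi0 (depthCoeff_eq_zero h hi3)) hc ?_ ?_
  · rw [mem_depthSubgroup_succ, and_iff_right (mul_pow_mem hF hc)]
    by_contra h0
    have hck := depthSubgroup_anti (by omega : i + 1 ≤ k) hc
    refine hki (natCast_eq_of_commute hi (by omega) (mul_mem hFi
      (depthSubgroup_anti (Nat.le_succ i) hck)) ?_ (mul_pow_mem hF hc) h0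
      (Commute.self_pow (F * c) p).eq)
    rw [depthCoeff_mul hi hFi (depthSubgroup_anti (Nat.le_succ i) hck) (by omega),
      depthCoeff_eq_zero hck (Nat.lt_succ_self i), add_zero]
    exact hFi0
  · intro h hmem
    have h1 : (h * F)⁻¹ * (F * h) = c * ((F * c)⁻¹ * (h⁻¹ * F * h)) := by group
    have h2 := depthSubgroup_anti (Nat.le_succ k) hmem
    have h3 := hcomm h (by rw [h1]; exact mul_mem hc h2)
    rw [h1, depthCoeff_mul (by omega) hc h2 (by omega),
      depthCoeff_eq_zero hmem (Nat.lt_succ_self k), add_zero] at h3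
    exact hc0 h3

/-! ### Beauville structures -/

lemma isBeauvilleGroup_of_five_le (hp : 5 ≤ p) {n : ℕ} (hn : 2 ≤ n)
    {W : Subgroup (nottinghamGroup p)} [W.Normal] (hW : IsBeauvilleKernel W n) :
    IsBeauvilleGroup (nottinghamGroup p ⧸ W) := by
  have hp2 : p ≠ 2 := by omega
  have h2 : (2 : ZMod p) ≠ 0 := fun h => by
    have := Nat.le_of_dvd (by norm_num)
      ((CharP.cast_eq_zero_iff (ZMod p) p 2).mp (by exact_mod_cast h))
    omega
  have h3 : (3 : ZMod p) ≠ 0 := fun h => by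
    have := Nat.le_of_dvd (by norm_num)
      ((CharP.cast_eq_zero_iff (ZMod p) p 3).mp (by exact_mod_cast h))
    omega
  obtain ⟨x₁, hx₁, hx₁l, hx₁q⟩ := exists_pow_eq_one_lin (p := p)
  obtain ⟨y₁, hy₁, hy₁l, hy₁q⟩ := exists_pow_eq_one_quad hp2
  obtain ⟨x₂, hx₂l, hx₂q⟩ := exists_lin_quad (p := p) 1 (-1)
  obtain ⟨y₂, hy₂l, hy₂q⟩ := exists_lin_quad (p := p) 1 2
  have hW3 := hW.le_three hn
  refine isBeauvilleGroup_quotient (x₁ := x₁) (y₁ := y₁) (x₂ := x₂) (y₂ := y₂)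
    (by rw [hW.index_eq]; exact pow_ne_zero _ (by omega))
    (fun H hH hx hy => eq_top_of_mem hp2 hx hy ?_ (hW.depthSubgroup_le.trans hH))
    (fun H hH hx hy => eq_top_of_mem hp2 hx hy ?_ (hW.depthSubgroup_le.trans hH)) ?_
  · simp [hx₁l, hx₁q, hy₁l, hy₁q]
  · rw [hx₂l, hx₂q, hy₂l, hy₂q]; ring_nf; exact h3
  have hdir : ∀ f', (f' = x₂ ∨ f' = y₂ ∨ f' = x₂ * y₂) →
      lin f' ≠ 0 ∧ quad f' ≠ 0 ∧ quad f' ≠ lin f' := by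
    rintro f' (rfl | rfl | rfl)
    · rw [hx₂l, hx₂q]
      exact ⟨one_ne_zero, neg_ne_zero.mpr one_ne_zero, fun h => h2 (by linear_combination -h)⟩
    · rw [hy₂l, hy₂q]
      exact ⟨one_ne_zero, h2, fun h => one_ne_zero (α := ZMod p) (by linear_combination h)⟩
    · rw [lin_mul, quad_mul, hx₂l, hx₂q, hy₂l, hy₂q]
      norm_num [h2]
      exact fun h => one_ne_zero (α := ZMod p) (by linear_combination -h)
  rintro f (rfl | rfl | rfl) f' hf' <;> obtain ⟨hl, hq, hlq⟩ := hdir f' hf'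
  · exact meetsTrivially_of_pow_eq_one hW3 hx₁ (by rwa [hx₁l, hx₁q, one_mul, mul_zero, sub_zero])
  · exact meetsTrivially_of_pow_eq_one hW3 hy₁ (by
      rwa [hy₁l, hy₁q, zero_mul, mul_one, zero_sub, neg_ne_zero])
  · refine meetsTrivially_of_quad_eq_lin hp2 hn hW ?_ ?_ hlq <;>
      simp [lin_mul, quad_mul, hx₁l, hx₁q, hy₁l, hy₁q]

lemma isBeauvilleGroup_three {n : ℕ} (hn : 5 ≤ n) {W : Subgroup (nottinghamGroup 3)} [W.Normal]
    (hW : IsBeauvilleKernel W n) : IsBeauvilleGroup (nottinghamGroup 3 ⧸ W) := by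
  have hp2 : (3 : ℕ) ≠ 2 := by norm_num
  obtain ⟨x₁, hx₁, hx₁l, hx₁q⟩ := exists_pow_eq_one_lin (p := 3)
  obtain ⟨y₁, hy₁, hy₁l, hy₁q⟩ := exists_pow_eq_one_quad hp2
  obtain ⟨c, hc, hc1, -⟩ := exists_monomial (p := 3) (k := 5) (by norm_num) 1
  obtain ⟨e, he, he1, -⟩ := exists_monomial (p := 3) (k := 4) (by norm_num) 1
  have hW6 : W ≤ depthSubgroup 3 6 := by
    refine hW.le_succ (by omega) fun h => ?_
    by_contra hlt
    obtain rfl : n = 5 := by omega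
    revert h; decide
  have hW3 : W ≤ depthSubgroup 3 3 := hW6.trans (depthSubgroup_anti (by norm_num))
  have hc3 := mem_depthSubgroup_three.mp (depthSubgroup_anti (by norm_num) hc)
  have he3 := mem_depthSubgroup_three.mp (depthSubgroup_anti (by norm_num) he)
  have hx₂l : lin (x₁ * c) = 1 := by rw [lin_mul, hx₁l, hc3.1, add_zero]
  have hx₂q : quad (x₁ * c) = 0 := by rw [quad_mul, hx₁q, hc3.2, add_zero]
  have hy₂l : lin (y₁⁻¹ * e) = 0 := by rw [lin_mul, lin_inv, hy₁l, he3.1, add_zero, neg_zero]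
  have hy₂q : quad (y₁⁻¹ * e) = -1 := by rw [quad_mul, quad_inv, hy₁q, he3.2, add_zero]
  have hxx : MeetsTrivially W x₁ (x₁ * c) :=
    meetsTrivially_mul (i := 1) le_rfl (by norm_num) (by norm_num) (by decide) hW6 hx₁
      (mem_depthSubgroup_one x₁) (by rw [← lin_def, hx₁l]; exact one_ne_zero) hc
      (by rw [hc1]; exact one_ne_zero) fun h hh =>
        depthCoeff_five_commutator (by rw [hx₁l]; exact one_ne_zero) hh
  have hyl : lin y₁⁻¹ = 0 := by rw [lin_inv, hy₁l, neg_zero]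
  have hyq : quad y₁⁻¹ ≠ 0 := by rw [quad_inv, hy₁q]; decide
  have hyy : MeetsTrivially W y₁ (y₁⁻¹ * e) := by
    rw [← inv_inv y₁, inv_inv y₁⁻¹]
    refine MeetsTrivially.inv_left ?_
    refine meetsTrivially_mul (i := 2) (by norm_num) (by norm_num) (by norm_num) (by decide)
      (hW6.trans (depthSubgroup_anti (by norm_num))) (by rw [inv_pow, hy₁, inv_one])
      (mem_depthSubgroup_two.mpr hyl) ?_ he (by rw [he1]; exact one_ne_zero) fun h hh =>
        depthCoeff_four_commutator hyl hyq hh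
    rw [quad_def, ← lin_def, hyl] at hyq
    simpa using hyq
  refine isBeauvilleGroup_quotient (x₁ := x₁) (y₁ := y₁) (x₂ := x₁ * c) (y₂ := y₁⁻¹ * e)
    (by rw [hW.index_eq]; exact pow_ne_zero _ (by norm_num))
    (fun H hH hx hy => eq_top_of_mem hp2 hx hy ?_ (hW.depthSubgroup_le.trans hH))
    (fun H hH hx hy => eq_top_of_mem hp2 hx hy ?_ (hW.depthSubgroup_le.trans hH)) ?_
  · rw [hx₁l, hx₁q, hy₁l, hy₁q]; decide
  · rw [hx₂l, hx₂q, hy₂l, hy₂q]; decide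
  rintro f (rfl | rfl | rfl) f' (rfl | rfl | rfl)
  · exact hxx
  · exact meetsTrivially_of_pow_eq_one hW3 hx₁ (by rw [hx₁l, hx₁q, hy₂l, hy₂q]; decide)
  · exact meetsTrivially_of_pow_eq_one hW3 hx₁ (by
      rw [lin_mul, quad_mul, hx₂l, hx₂q, hx₁l, hx₁q, hy₂l, hy₂q]; decide)
  · exact meetsTrivially_of_pow_eq_one hW3 hy₁ (by rw [hy₁l, hy₁q, hx₂l, hx₂q]; decide)
  · exact hyy
  · exact meetsTrivially_of_pow_eq_one hW3 hy₁ (by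
      rw [lin_mul, quad_mul, hx₂l, hx₂q, hy₁l, hy₁q, hy₂l, hy₂q]; decide)
  all_goals
    refine meetsTrivially_of_quad_eq_lin hp2 (by omega) hW ?_ ?_ ?_
    · rw [lin_mul, hx₁l, hy₁l]; decide
    · rw [lin_mul, quad_mul, hx₁l, hy₁l, hx₁q, hy₁q]; decide
  · rw [hx₂l, hx₂q]; decide
  · rw [hy₂l, hy₂q]; decide
  · rw [lin_mul, quad_mul, hx₂l, hx₂q, hy₂l, hy₂q]; decide

lemma exists_beauville_quotient (hp : Odd p) {n : ℕ} (hn : (if p = 3 then 5 else 2) ≤ n) :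
    ∃ (W : Subgroup (nottinghamGroup p)) (_ : W.Normal),
      Nat.card (nottinghamGroup p ⧸ W) = p ^ n ∧ IsBeauvilleGroup (nottinghamGroup p ⧸ W) := by
  have hn2 : 2 ≤ n := le_trans (by split_ifs <;> norm_num) hn
  obtain ⟨W, hWn, hW⟩ := exists_isBeauvilleKernel (p := p) hn2
  refine ⟨W, hWn, hW.index_eq, ?_⟩
  by_cases h3 : p = 3
  · subst h3
    exact isBeauvilleGroup_three (by simpa using hn) hW
  · refine isBeauvilleGroup_of_five_le ?_ hn2 hW
    have h2 := (Fact.out : p.Prime).two_le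
    obtain ⟨k, hk⟩ := hp
    omega

end Nottingham

theorem theoremB :
    (∀ (p : ℕ) [Fact p.Prime], Odd p → ∀ n : ℕ, (if p = 3 then 5 else 2) ≤ n →
      ∃ (W : Subgroup (nottinghamGroup p)) (_ : W.Normal),
        Nat.card (nottinghamGroup p ⧸ W) = p ^ n ∧
        IsBeauvilleGroup (nottinghamGroup p ⧸ W)) ∧
    (∀ n : ℕ, 5 ≤ n →
      ∃ (W : Subgroup (nottinghamGroup 3)) (_ : W.Normal),
        Nat.card (nottinghamGroup 3 ⧸ W) = 3 ^ n ∧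
        IsBeauvilleGroup (nottinghamGroup 3 ⧸ W)) :=
  ⟨fun _ _ hp _ hn => Nottingham.exists_beauville_quotient hp hn,
    fun _ hn => Nottingham.exists_beauville_quotient (by decide) (by simpa using hn)⟩
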